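/- A Rogers–Ramanujan partition is a partition (a finite, possibly empty, multiset of positive integers) whose parts differ pairwise by at least $2$; in particular its parts are distinct. A chain of such a partition is a maximal block of parts differing by $2$, that is, a maximal nonempty set of parts of the form $\{a, a+2, \dots, a+2(\ell-1)\}$. All parts of a chain $\chi$ have the same parity, and $\chi$ is called even if its parts are even; $\lambda(\chi)$ denotes the least part of $\chi$. Let $\mathcal{R}_2$ be the set of Rogers–Ramanujan partitions that do not have $1$ as a part, and for $\pi \in \mathcal{R}_2$ let $\omega_2(\pi) = 2^{r}$, where $r$ is the number of even chains $\chi$ of $\pi$ with $\lambda(\chi) > 2$. Let $A_{6,1}(n)$ denote the number of partitions of $n$ into parts $\not\equiv 0, \pm 1 \pmod 6$, and let $\sigma(\pi)$ denote the sum of the parts of $\pi$. Then for every integer $n \ge 0$, $$A_{6,1}(n) = \sum_{\pi \in \mathcal{R}_2,\ \sigma(\pi) = n} \omega_2(\pi).$$ -/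

import Mathlib

namespace RogersRamanujan

/-- A partition is a Rogers-Ramanujan partition if its parts differ by at least `2`
(in particular no part is repeated). -/
def IsRR {n : ℕ} (π : n.Partition) : Prop :=
  π.parts.Nodup ∧ ∀ a ∈ π.parts, ∀ b ∈ π.parts, a < b → a + 2 ≤ b

/-- The set of Rogers-Ramanujan partitions of `n` not having `1` as a part. -/
noncomputable def rr2 (n : ℕ) : Finset n.Partition :=
  open scoped Classical in Finset.univ.filter fun π => IsRR π ∧ 1 ∉ π.parts

/-- A block: a nonempty set `{a, a + 2, …, a + 2 (ℓ - 1)}` of integers in which successive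
elements differ by `2`. -/
def IsBlock (s : Finset ℕ) : Prop :=
  ∃ a ℓ : ℕ, 0 < ℓ ∧ s = (Finset.range ℓ).image fun j => a + 2 * j

/-- A chain of `π`: a maximal block of parts of `π` differing by `2`. -/
def IsChain {n : ℕ} (π : n.Partition) (χ : Finset ℕ) : Prop :=
  Maximal (fun s : Finset ℕ => IsBlock s ∧ ∀ m ∈ s, m ∈ π.parts) χ

/-- The chains of `π`. -/
noncomputable def chains {n : ℕ} (π : n.Partition) : Finset (Finset ℕ) :=
  open scoped Classical in π.parts.toFinset.powerset.filter fun χ => IsChain π χ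

/-- The least part `λ(χ)` of a (nonempty) chain `χ`. -/
noncomputable def leastPart (χ : Finset ℕ) : ℕ := sInf (χ : Set ℕ)

/-- The even chains of `π` with least part greater than `2`. -/
noncomputable def evenChains {n : ℕ} (π : n.Partition) : Finset (Finset ℕ) :=
  open scoped Classical in
    (chains π).filter fun χ => (∀ m ∈ χ, Even m) ∧ 2 < leastPart χ

/-- The weight `2 ^ r`, with `r` the number of even chains of least part greater than `2`. -/
noncomputable def weight2 {n : ℕ} (π : n.Partition) : ℕ := 2 ^ (evenChains π).card

/-- The number of partitions of `n` into parts not congruent to `0`, `1` or `-1` modulo `6`. -/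
def A61 (n : ℕ) : ℕ :=
  (Nat.Partition.restricted n fun m =>
    ¬ (m : ℤ) ≡ 0 [ZMOD 6] ∧ ¬ (m : ℤ) ≡ 1 [ZMOD 6] ∧ ¬ (m : ℤ) ≡ -1 [ZMOD 6]).card

end RogersRamanujan

/-! Bound the parts by `m`, let `G m` be the weighted generating polynomial (`sparseGenFun`), and
split on whether the largest allowed part occurs. Eliminating the even indices leaves a three-term
recurrence for `G (2L+1)`.

The alternating sum `∑ (-1)^r q^(3r²+2r) [2L+2, L-3r]_q` has the same recurrence
(`thetaSum.recurrence`) and initial values, so the two agree (`algebraMap_sparseGenFun`). As `L → ∞`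
the binomials tend to `1/(q;q)_∞`, leaving the theta series `∑ (-1)^r q^(3r²+2r)`. By Jacobi's
triple product, obtained from its finite form `thetaSum.eq_prod`, this series is the product of `1 -
q^j` over `j ≡ 0, ±1 mod 6`. Dividing by `(q;q)_∞` leaves the inverse product over `j ≡ 2, 3, 4 mod
6`, which counts the restricted partitions.

The limits are taken modulo `X^N`, where they become exact equalities. The recurrences are proved in
a field, since reindexing produces negative exponents. -/

/-! ### Gaussian binomial coefficients. -/

/-- The Gaussian binomial coefficient with an integral lower index. -/
def gaussBinom {R : Type*} [CommRing R] (q : R) : ℕ → ℤ → R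
  | 0, k => if k = 0 then 1 else 0
  | n + 1, k => gaussBinom q n (k - 1) + q ^ k.toNat * gaussBinom q n k

namespace gaussBinom

section CommRing

variable {R : Type*} [CommRing R] (q : R)

theorem zero_apply (k : ℤ) : gaussBinom q 0 k = if k = 0 then 1 else 0 := rfl

theorem succ_apply (n : ℕ) (k : ℤ) :
    gaussBinom q (n + 1) k = gaussBinom q n (k - 1) + q ^ k.toNat * gaussBinom q n k := rfl

/-- This vanishing makes the truncation in `k.toNat` harmless; with `eq_zero_of_lt` it makes the
bilateral sums finite. -/
theorem eq_zero_of_neg (n : ℕ) {k : ℤ} (hk : k < 0) : gaussBinom q n k = 0 := by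
  induction n generalizing k with
  | zero => simp [zero_apply, hk.ne]
  | succ n ih => rw [succ_apply, ih hk, ih (by omega)]; simp

theorem eq_zero_of_lt {n : ℕ} {k : ℤ} (hk : (n : ℤ) < k) : gaussBinom q n k = 0 := by
  induction n generalizing k with
  | zero => rw [zero_apply, if_neg (by simpa using hk.ne')]
  | succ n ih => push_cast at hk; rw [succ_apply, ih (by omega), ih (by omega)]; simp

theorem apply_zero (n : ℕ) : gaussBinom q n 0 = 1 := by
  induction n with
  | zero => simp [zero_apply]
  | succ n ih => simp [succ_apply, ih, eq_zero_of_neg]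

theorem map {S : Type*} [CommRing S] (f : R →+* S) (n : ℕ) (k : ℤ) :
    f (gaussBinom q n k) = gaussBinom (f q) n k := by
  induction n generalizing k with
  | zero => simp only [zero_apply]; split_ifs <;> simp
  | succ n ih => simp [succ_apply, ih]

/-- The second `q`-Pascal rule. -/
theorem succ_apply' (n : ℕ) (k : ℤ) : gaussBinom q (n + 1) k =
    q ^ (n + 1 - k).toNat * gaussBinom q n (k - 1) + gaussBinom q n k := by
  induction n generalizing k with
  | zero =>
    simp only [zero_apply, succ_apply]
    rcases lt_trichotomy k 0 with h | h | h
    · rw [if_neg (by omega), if_neg (by omega)]; simp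
    · subst h; simp
    · by_cases h1 : k = 1
      · subst h1; simp
      · rw [if_neg (by omega), if_neg (by omega)]; simp
  | succ n ih =>
    rw [succ_apply q (n + 1) k]
    conv_lhs => rw [ih (k - 1), ih k]
    conv_rhs => rw [succ_apply q n (k - 1), succ_apply q n k]
    have e1 : (((n : ℤ) + 1 - (k - 1)).toNat) = (((n + 1 : ℕ) : ℤ) + 1 - k).toNat := by
      push_cast; congr 1; ring
    rw [e1]
    rcases lt_or_ge k 1 with h | h
    · rw [eq_zero_of_neg q n (show k - 1 < 0 by omega),
        eq_zero_of_neg q n (show k - 1 - 1 < 0 by omega)]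
      ring
    · rcases lt_or_ge ((n : ℤ) + 1) k with h2 | h2
      · rw [eq_zero_of_lt q (show (n : ℤ) < k by omega),
          eq_zero_of_lt q (show (n : ℤ) < k - 1 by omega)]
        ring
      · obtain ⟨a, rfl⟩ : ∃ a : ℕ, k = a + 1 := ⟨(k - 1).toNat, by omega⟩
        obtain ⟨b, rfl⟩ : ∃ b : ℕ, n = a + b := ⟨n - a, by omega⟩
        have e2 : ((a : ℤ) + 1).toNat = a + 1 := by omega
        have e3 : ((a : ℤ) + 1 - 1).toNat = a := by omega
        have e4 : (((a + b : ℕ) : ℤ) + 1 - (a + 1)).toNat = b := by omega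
        have e5 : (((a + b + 1 : ℕ) : ℤ) + 1 - (a + 1)).toNat = b + 1 := by omega
        rw [e2, e3, e4, e5]
        ring

/-- Absorption. -/
theorem one_sub_pow_mul (n k : ℕ) : (1 - q ^ (k + 1)) * gaussBinom q (n + 1) (k + 1) =
    (1 - q ^ (n + 1)) * gaussBinom q n k := by
  have h1 := succ_apply q n (k + 1)
  have h2 := succ_apply' q n (k + 1)
  rw [add_sub_cancel_right, show ((k : ℤ) + 1).toNat = k + 1 by omega] at h1
  rw [add_sub_cancel_right, show ((n : ℤ) + 1 - (k + 1)).toNat = n - k by omega] at h2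
  rcases le_or_gt k n with h | h
  · obtain ⟨b, rfl⟩ := Nat.exists_eq_add_of_le h
    rw [Nat.add_sub_cancel_left] at h2
    linear_combination h1 - q ^ (k + 1) * h2
  · rw [eq_zero_of_lt q (show ((n + 1 : ℕ) : ℤ) < (k : ℤ) + 1 by omega),
      eq_zero_of_lt q (show (n : ℤ) < k by omega)]
    simp

theorem mul_prod (a b : ℕ) : gaussBinom q (a + b) a * ∏ i ∈ Finset.range a, (1 - q ^ (i + 1)) =
    ∏ i ∈ Finset.range a, (1 - q ^ (b + i + 1)) := by
  induction a with
  | zero => simp [apply_zero]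
  | succ a ih =>
    rw [Finset.prod_range_succ, Finset.prod_range_succ, ← ih, show a + 1 + b = a + b + 1 by ring]
    have := one_sub_pow_mul q (a + b) a
    push_cast
    rw [show b + a + 1 = a + b + 1 by ring]
    linear_combination (∏ i ∈ Finset.range a, (1 - q ^ (i + 1))) * this

theorem hasFiniteSupport (n : ℕ) (a c : ℤ) (hc : 0 < c) (f : ℤ → R) :
    (Function.support fun r : ℤ => f r * gaussBinom q n (a - c * r)).Finite := by
  refine (Set.finite_Icc (-(|a| + n)) (|a| + n)).subset fun r hr => ?_
  by_contra h
  apply hr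
  rw [Set.mem_Icc, not_and_or, not_le, not_le] at h
  have ha := neg_abs_le a
  have ha' := le_abs_self a
  have hn : (0 : ℤ) ≤ n := by positivity
  rcases h with h | h
  · have : (n : ℤ) < a - c * r := by nlinarith
    simp [eq_zero_of_lt q this]
  · have : a - c * r < 0 := by nlinarith
    simp [eq_zero_of_neg q n this]

end CommRing

section Field

variable {K : Type*} [Field K] (q : K)

theorem succ_zpow (n : ℕ) (k : ℤ) :
    gaussBinom q (n + 1) k = gaussBinom q n (k - 1) + q ^ k * gaussBinom q n k := by
  rw [succ_apply]
  rcases lt_or_ge k 0 with h | h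
  · simp [eq_zero_of_neg q n h]
  · rw [← zpow_natCast, Int.toNat_of_nonneg h]

theorem succ_zpow' (n : ℕ) (k : ℤ) : gaussBinom q (n + 1) k =
    q ^ ((n : ℤ) + 1 - k) * gaussBinom q n (k - 1) + gaussBinom q n k := by
  rw [succ_apply']
  rcases lt_or_ge ((n : ℤ) + 1) k with h | h
  · simp [eq_zero_of_lt q (show (n : ℤ) < k - 1 by omega)]
  · rw [← zpow_natCast, Int.toNat_of_nonneg (by omega)]

theorem one_sub_zpow_mul (n : ℕ) (k : ℤ) : (1 - q ^ k) * gaussBinom q (n + 1) k =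
    (1 - q ^ (n + 1)) * gaussBinom q n (k - 1) := by
  rcases lt_or_ge 0 k with h | h
  · obtain ⟨a, rfl⟩ : ∃ a : ℕ, k = (a : ℤ) + 1 := ⟨(k - 1).toNat, by omega⟩
    have := one_sub_pow_mul q n a
    rwa [add_sub_cancel_right, ← Nat.cast_succ, zpow_natCast]
  · rw [eq_zero_of_neg q n (show k - 1 < 0 by omega)]
    rcases h.eq_or_lt with rfl | h
    · simp
    · simp [eq_zero_of_neg q _ h]

/-- Two steps of the `q`-Pascal rules, symmetric in the two lower arguments. -/
theorem add_two_zpow (hq : q ≠ 0) (n : ℕ) (k : ℤ) : gaussBinom q (n + 2) k =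
    (1 + q ^ ((n : ℤ) + 1)) * gaussBinom q n (k - 1)
      + q ^ ((n : ℤ) + 2 - k) * gaussBinom q n (k - 2) + q ^ k * gaussBinom q n k := by
  have e : q ^ ((n : ℤ) + 1) = q ^ k * q ^ ((n : ℤ) + 1 - k) := by
    rw [← zpow_add₀ hq]; congr 1; ring
  rw [succ_zpow, succ_zpow' q n (k - 1), succ_zpow' q n k, e]
  rw [show (n : ℤ) + 1 - (k - 1) = n + 2 - k by ring, show k - 1 - 1 = k - 2 by ring]
  ring

end Field

end gaussBinom

/-! ### Alternating theta sums and their recurrences. -/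

/-- The sum `∑ (-1) ^ r q ^ (3 r ^ 2 + a r + b) [n, c - d r]` over all integers `r`, where the
Gaussian binomial coefficient has base `p`. -/
noncomputable def thetaSum {K : Type*} [Field K] (q p : K) (n : ℕ) (d a b c : ℤ) : K :=
  ∑ᶠ r : ℤ, (-1) ^ r * q ^ (3 * r ^ 2 + a * r + b) * gaussBinom p n (c - d * r)

namespace thetaSum

variable {K : Type*} [Field K] {q p : K}

theorem hasFiniteSupport (n : ℕ) {d : ℤ} (hd : 0 < d) (a b c : ℤ) :
    Function.HasFiniteSupport fun r : ℤ =>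
      (-1 : K) ^ r * q ^ (3 * r ^ 2 + a * r + b) * gaussBinom p n (c - d * r) :=
  gaussBinom.hasFiniteSupport p n c d hd fun r => (-1) ^ r * q ^ (3 * r ^ 2 + a * r + b)

/-- Substitute `r + 1` for `r`. The sign change is the source of all cancellations below. -/
theorem shift (n : ℕ) (d a b c : ℤ) :
    thetaSum q p n d a b c = -thetaSum q p n d (a + 6) (a + b + 3) (c - d) := by
  unfold thetaSum
  rw [← finsum_comp_equiv (Equiv.addRight (1 : ℤ)), ← finsum_neg_distrib]
  refine finsum_congr fun r => ?_
  rw [Equiv.coe_addRight, zpow_add_one₀ (by simp)]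
  rw [show 3 * (r + 1) ^ 2 + a * (r + 1) + b = 3 * r ^ 2 + (a + 6) * r + (a + b + 3) by ring,
    show c - d * (r + 1) = c - d - d * r by ring]
  ring

theorem mul_zpow (hq : q ≠ 0) (n : ℕ) (d a b c e : ℤ) :
    q ^ e * thetaSum q p n d a b c = thetaSum q p n d a (b + e) c := by
  unfold thetaSum
  rw [← smul_eq_mul, smul_finsum]
  refine finsum_congr fun r => ?_
  rw [smul_eq_mul, ← add_assoc, zpow_add₀ hq _ e]
  ring

/-- The symmetric double step of the `q`-Pascal rules, summed. -/
theorem add_two (hq : q ≠ 0) (n : ℕ) {d : ℤ} (hd : 0 < d) (m : ℕ) (a b c : ℤ) :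
    thetaSum q (q ^ m) (n + 2) d a b c =
      thetaSum q (q ^ m) n d a b (c - 1)
      + thetaSum q (q ^ m) n d a (b + m * (n + 1)) (c - 1)
      + thetaSum q (q ^ m) n d (a + m * d) (b + m * (n + 2 - c)) (c - 2)
      + thetaSum q (q ^ m) n d (a - m * d) (b + m * c) c := by
  unfold thetaSum
  have h (a b c : ℤ) := hasFiniteSupport (q := q) (p := q ^ m) n hd a b c
  rw [← finsum_add_distrib (h _ _ _) (h _ _ _), ← finsum_add_distrib ((h _ _ _).fun_add (h _ _ _))
    (h _ _ _), ← finsum_add_distrib (((h _ _ _).fun_add (h _ _ _)).fun_add (h _ _ _)) (h _ _ _)]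
  refine finsum_congr fun r => ?_
  rw [gaussBinom.add_two_zpow _ (pow_ne_zero m hq)]
  simp only [← zpow_natCast q m, ← zpow_mul]
  rw [show 3 * r ^ 2 + a * r + (b + m * (n + 1)) = (3 * r ^ 2 + a * r + b) + m * (n + 1) by ring,
    show 3 * r ^ 2 + (a + m * d) * r + (b + m * (n + 2 - c)) =
      (3 * r ^ 2 + a * r + b) + m * (n + 2 - (c - d * r)) by ring,
    show 3 * r ^ 2 + (a - m * d) * r + (b + m * c) =
      (3 * r ^ 2 + a * r + b) + m * (c - d * r) by ring,
    zpow_add₀ hq (3 * r ^ 2 + a * r + b), zpow_add₀ hq (3 * r ^ 2 + a * r + b),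
    zpow_add₀ hq (3 * r ^ 2 + a * r + b), show c - d * r - 1 = c - 1 - d * r by ring,
    show c - d * r - 2 = c - 2 - d * r by ring]
  ring

theorem succ (hq : q ≠ 0) (n : ℕ) {d : ℤ} (hd : 0 < d) (a b c : ℤ) :
    thetaSum q q (n + 1) d a b c =
      thetaSum q q n d a b (c - 1) + thetaSum q q n d (a - d) (b + c) c := by
  unfold thetaSum
  rw [← finsum_add_distrib (hasFiniteSupport n hd _ _ _) (hasFiniteSupport n hd _ _ _)]
  refine finsum_congr fun r => ?_
  rw [gaussBinom.succ_zpow, show 3 * r ^ 2 + (a - d) * r + (b + c) =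
      (3 * r ^ 2 + a * r + b) + (c - d * r) by ring, zpow_add₀ hq (3 * r ^ 2 + a * r + b),
    show c - d * r - 1 = c - 1 - d * r by ring]
  ring

theorem succ' (hq : q ≠ 0) (n : ℕ) {d : ℤ} (hd : 0 < d) (a b c : ℤ) :
    thetaSum q q (n + 1) d a b c =
      thetaSum q q n d (a + d) (b + (n + 1 - c)) (c - 1) + thetaSum q q n d a b c := by
  unfold thetaSum
  rw [← finsum_add_distrib (hasFiniteSupport n hd _ _ _) (hasFiniteSupport n hd _ _ _)]
  refine finsum_congr fun r => ?_
  rw [gaussBinom.succ_zpow', show 3 * r ^ 2 + (a + d) * r + (b + (n + 1 - c)) =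
      (3 * r ^ 2 + a * r + b) + (n + 1 - (c - d * r)) by ring,
    zpow_add₀ hq (3 * r ^ 2 + a * r + b),
    show c - d * r - 1 = c - 1 - d * r by ring]
  ring

/-- The factor `q ^ (c - d r)` from absorption has exponent affine in `r`, so it only changes `a`
and `b`. -/
theorem absorb (hq : q ≠ 0) (n : ℕ) {d : ℤ} (hd : 0 < d) (a b c : ℤ) :
    thetaSum q q (n + 1) d a b c - thetaSum q q (n + 1) d (a - d) (b + c) c =
      (1 - q ^ (n + 1)) * thetaSum q q n d a b (c - 1) := by
  unfold thetaSum
  rw [← finsum_sub_distrib (hasFiniteSupport _ hd _ _ _) (hasFiniteSupport _ hd _ _ _),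
    ← smul_eq_mul, smul_finsum]
  refine finsum_congr fun r => ?_
  have := gaussBinom.one_sub_zpow_mul q n (c - d * r)
  rw [show 3 * r ^ 2 + (a - d) * r + (b + c) =
      (3 * r ^ 2 + a * r + b) + (c - d * r) by ring, zpow_add₀ hq (3 * r ^ 2 + a * r + b), smul_eq_mul,
    show c - 1 - d * r = c - d * r - 1 by ring]
  linear_combination (-1) ^ r * q ^ (3 * r ^ 2 + a * r + b) * this

/-- The finite form of Jacobi's triple product identity at `z = -q ^ 2` and base `q ^ 6`. -/
theorem eq_prod (hq : q ≠ 0) (n : ℕ) : thetaSum q (q ^ 6) (2 * n) 1 2 0 n =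
    ∏ k ∈ Finset.range n, (1 - q ^ (6 * k + 1)) * (1 - q ^ (6 * k + 5)) := by
  induction n with
  | zero =>
    unfold thetaSum
    rw [finsum_eq_single _ 0 fun r hr => by simp [gaussBinom.zero_apply, hr]]
    simp [gaussBinom.zero_apply]
  | succ n ih =>
    rw [Finset.prod_range_succ, ← ih, show 2 * (n + 1) = 2 * n + 2 by ring,
      add_two hq _ one_pos, shift (2 * n) 1 (2 - _)]
    -- The double step gives four terms. After shifts the last two become `-q^(6n+1)` and
    -- `-q^(6n+5)` times the sum, so the total factor is `1 + q^(12n+6) - q^(6n+1) - q^(6n+5)`.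
    have h := shift (q := q) (p := q ^ 6) (2 * n) 1 2 (6 * n + 1) n
    have e (b : ℕ) := mul_zpow (p := q ^ 6) hq (2 * n) 1 2 0 n b
    have e1 := e (6 * n + 1)
    have e2 := e (6 * n + 5)
    have e3 := e (6 * (2 * n + 1))
    rw [zpow_natCast] at e1 e2 e3
    push_cast at *
    ring_nf at *
    linear_combination e1 + e2 - e3 + h

/-- The three-term recurrence in steps of two. -/
theorem recurrence (hq : q ≠ 0) (L : ℕ) :
    thetaSum q q (2 * L + 6) 3 2 0 (L + 2) =
      (1 + q ^ (2 * L + 4) + q ^ (2 * L + 5)) * thetaSum q q (2 * L + 4) 3 2 0 (L + 1)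
      + q ^ (2 * L + 4) * (1 - q ^ (2 * L + 3)) * thetaSum q q (2 * L + 2) 3 2 0 L := by
  -- `s1` yields the terms `1` and `q^(2L+5)` plus two others. By `s2` to `s5` those two reduce to
  -- `q^(2L+4)` times the sums of length `2L+3` centred at `L+1` and `L`; `s6` and `s7` convert
  -- these to lengths `2L+4` and `2L+2`.
  have s1 := add_two hq (2 * L + 4) three_pos 1 2 0 (L + 2)
  have s2 := shift (q := q) (p := q) (2 * L + 4) 3 (-1) (L + 2) (L + 3)
  have s3 := succ' hq (2 * L + 3) three_pos (-1) (L + 2) (L + 2)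
  have s4 := succ hq (2 * L + 3) three_pos (-1) (L + 2) (L + 3)
  have s5 := shift (q := q) (p := q) (2 * L + 3) 3 (-4) (2 * L + 5) (L + 3)
  have s6 := succ hq (2 * L + 3) three_pos 2 0 (L + 1)
  have s7 := absorb hq (2 * L + 2) three_pos 2 0 (L + 1)
  have e1 := mul_zpow (p := q) hq (2 * L + 4) 3 2 0 (L + 1) (2 * L + 5 : ℕ)
  have e2 := mul_zpow (p := q) hq (2 * L + 3) 3 2 0 (L + 1) (2 * L + 4 : ℕ)
  have e3 := mul_zpow (p := q) hq (2 * L + 3) 3 2 0 L (2 * L + 4 : ℕ)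
  rw [zpow_natCast] at e1 e2 e3
  simp only [pow_one] at s1
  push_cast at *
  ring_nf at *
  linear_combination s1 + s2 + s3 - s4 - s5 - e1 - e2 - e3 - q ^ 4 * q ^ (L * 2) * s6 + q ^ 4 * q ^ (L * 2) * s7

end thetaSum

/-! ### Weighted generating polynomials with bounded parts. -/

/-- The finite subsets of `{2, …, m}` without two consecutive elements. -/
def sparseSets (m : ℕ) : Finset (Finset ℕ) :=
  (Finset.Icc 2 m).powerset.filter fun S => ∀ a ∈ S, a + 1 ∉ S

/-- The even elements `a > 2` of `S` for which `a - 2` is not in `S`. -/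
def evenStarts (S : Finset ℕ) : Finset ℕ :=
  S.filter fun a => Even a ∧ 2 < a ∧ a - 2 ∉ S

/-- The generating polynomial of `sparseSets m` with weights `2 ^ #(evenStarts S)`. -/
noncomputable def sparseGenFun (m : ℕ) : PowerSeries ℤ :=
  ∑ S ∈ sparseSets m, 2 ^ (evenStarts S).card * PowerSeries.X ^ ∑ a ∈ S, a

theorem mem_sparseSets {m : ℕ} {S : Finset ℕ} :
    S ∈ sparseSets m ↔ (∀ a ∈ S, 2 ≤ a ∧ a ≤ m) ∧ ∀ a ∈ S, a + 1 ∉ S := by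
  simp [sparseSets, Finset.subset_iff]

theorem filter_notMem_sparseSets_succ (m : ℕ) :
    (sparseSets (m + 1)).filter (fun S => m + 1 ∉ S) = sparseSets m := by
  ext S
  simp only [Finset.mem_filter, mem_sparseSets]
  constructor
  · rintro ⟨⟨h1, h2⟩, h3⟩
    refine ⟨fun a ha => ⟨(h1 a ha).1, ?_⟩, h2⟩
    have := (h1 a ha).2
    have : a ≠ m + 1 := fun h => h3 (h ▸ ha)
    omega
  · rintro ⟨h1, h2⟩
    refine ⟨⟨fun a ha => ⟨(h1 a ha).1, (h1 a ha).2.trans (Nat.le_succ m)⟩, h2⟩, fun h => ?_⟩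
    have := (h1 _ h).2
    omega

theorem filter_mem_sparseSets_add_two (m : ℕ) (hm : 0 < m) :
    (sparseSets (m + 2)).filter (fun S => m + 2 ∈ S) =
      (sparseSets m).image (insert (m + 2)) := by
  ext S
  simp only [Finset.mem_filter, mem_sparseSets, Finset.mem_image]
  constructor
  · rintro ⟨⟨h1, h2⟩, h3⟩
    refine ⟨S.erase (m + 2), ⟨fun a ha => ?_, fun a ha => ?_⟩, Finset.insert_erase h3⟩
    · obtain ⟨ha, haS⟩ := Finset.mem_erase.1 ha
      have h := h1 a haS
      have : a ≠ m + 1 := fun h => h2 a haS (by rwa [h])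
      omega
    · exact fun h => h2 a (Finset.mem_of_mem_erase ha) (Finset.mem_of_mem_erase h)
  · rintro ⟨T, ⟨h1, h2⟩, rfl⟩
    refine ⟨⟨fun a ha => ?_, fun a ha => ?_⟩, Finset.mem_insert_self _ _⟩
    · rcases Finset.mem_insert.1 ha with rfl | ha
      · omega
      · have := h1 a ha
        omega
    · rw [Finset.mem_insert, not_or]
      rcases Finset.mem_insert.1 ha with rfl | ha
      · exact ⟨by omega, fun h => by have := h1 _ h; omega⟩
      · exact ⟨by have := h1 a ha; omega, h2 a ha⟩

theorem card_evenStarts_insert {m : ℕ} {S : Finset ℕ} (hS : S ∈ sparseSets (m + 1)) :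
    (evenStarts (insert (m + 3) S)).card =
      (evenStarts S).card + if Even (m + 3) ∧ m + 1 ∉ S then 1 else 0 := by
  rw [mem_sparseSets] at hS
  have hm : m + 3 ∉ S := fun h => by have := hS.1 _ h; omega
  have key : ∀ a ∈ S, (Even a ∧ 2 < a ∧ a - 2 ∉ insert (m + 3) S) ↔
      (Even a ∧ 2 < a ∧ a - 2 ∉ S) := fun a ha => by
    have := hS.1 a ha
    simp only [Finset.mem_insert, not_or]
    have : a - 2 ≠ m + 3 := by omega
    tauto
  unfold evenStarts
  rw [Finset.filter_insert, Finset.filter_congr key]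
  have h2 : (Even (m + 3) ∧ 2 < m + 3 ∧ m + 3 - 2 ∉ insert (m + 3) S) ↔
      (Even (m + 3) ∧ m + 1 ∉ S) := by
    simp
  rw [if_congr h2 rfl rfl]
  split_ifs
  · rw [Finset.card_insert_of_notMem (fun h => hm (Finset.mem_of_mem_filter _ h))]
  · rfl

/-- Adjoining `m + 3` doubles the weight exactly when it is even and `m + 1` is absent; the second
copy of those sets accounts for `sparseGenFun m`. -/
theorem sparseGenFun_add_three (m : ℕ) : sparseGenFun (m + 3) =
    sparseGenFun (m + 2) + PowerSeries.X ^ (m + 3) *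
      (sparseGenFun (m + 1) + if Even (m + 3) then sparseGenFun m else 0) := by
  conv_lhs => rw [sparseGenFun, ← Finset.sum_filter_not_add_sum_filter _ (fun S => m + 3 ∈ S)]
  rw [filter_notMem_sparseSets_succ (m + 2), filter_mem_sparseSets_add_two (m + 1) (by omega)]
  have hnot {S : Finset ℕ} (hS : S ∈ sparseSets (m + 1)) : m + 3 ∉ S := fun h => by
    have := (mem_sparseSets.1 hS).1 _ h
    omega
  rw [Finset.sum_image fun S hS T hT h => by
    rw [← Finset.erase_insert (hnot hS), ← Finset.erase_insert (hnot hT)]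
    exact congrArg (fun U => Finset.erase U (m + 3)) h]
  rw [sparseGenFun]
  congr 1
  have : ∀ S ∈ sparseSets (m + 1), (2 : PowerSeries ℤ) ^ (evenStarts (insert (m + 3) S)).card *
      PowerSeries.X ^ ∑ a ∈ insert (m + 3) S, a = PowerSeries.X ^ (m + 3) *
        (2 ^ (evenStarts S).card * PowerSeries.X ^ ∑ a ∈ S, a +
          if Even (m + 3) then (if m + 1 ∉ S then
            2 ^ (evenStarts S).card * PowerSeries.X ^ ∑ a ∈ S, a else 0) else 0) := fun S hS => by
    rw [card_evenStarts_insert hS, Finset.sum_insert (hnot hS)]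
    by_cases h1 : Even (m + 3) <;> by_cases h2 : m + 1 ∈ S <;> simp [h1, h2] <;> ring
  rw [Finset.sum_congr rfl this, ← Finset.mul_sum, Finset.sum_add_distrib, sparseGenFun]
  congr 2
  split_ifs
  · rw [← Finset.sum_filter, filter_notMem_sparseSets_succ, sparseGenFun]
  · simp

theorem sparseGenFun_one : sparseGenFun 1 = 1 := by
  have : sparseSets 1 = {∅} := by decide
  simp [sparseGenFun, this, evenStarts]

theorem sparseGenFun_three : sparseGenFun 3 = 1 + PowerSeries.X ^ 2 + PowerSeries.X ^ 3 := by
  have : sparseSets 3 = {∅, {2}, {3}} := by decide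
  have h2 : evenStarts {2} = ∅ := by decide
  have h3 : evenStarts {3} = ∅ := by decide
  simp [sparseGenFun, this, h2, h3, show evenStarts ∅ = ∅ from rfl, add_assoc]

/-- Three consecutive one-step recurrences, with the values at `2L+4` and `2L+2` eliminated. -/
theorem sparseGenFun_recurrence (L : ℕ) : sparseGenFun (2 * L + 5) =
    (1 + PowerSeries.X ^ (2 * L + 4) + PowerSeries.X ^ (2 * L + 5)) * sparseGenFun (2 * L + 3)
    + PowerSeries.X ^ (2 * L + 4) * (1 - PowerSeries.X ^ (2 * L + 3))
      * sparseGenFun (2 * L + 1) := by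
  have h1 := sparseGenFun_add_three (2 * L + 2)
  have h2 := sparseGenFun_add_three (2 * L + 1)
  have h3 := sparseGenFun_add_three (2 * L)
  rw [if_neg (by grind)] at h1 h3
  rw [if_pos (by grind)] at h2
  linear_combination h1 + h2 - PowerSeries.X ^ (2 * L + 4) * h3

/-- The bosonic form of `sparseGenFun`. -/
theorem algebraMap_sparseGenFun {K : Type*} [Field K] (f : PowerSeries ℤ →+* K)
    (hf : Function.Injective f) (L : ℕ) : f (sparseGenFun (2 * L + 1)) =
      thetaSum (f PowerSeries.X) (f PowerSeries.X) (2 * L + 2) 3 2 0 L := by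
  have hq : f PowerSeries.X ≠ 0 := by
    rw [ne_eq, map_eq_zero_iff f hf]
    exact PowerSeries.X_ne_zero
  induction L using Nat.twoStepInduction with
  | zero =>
    rw [thetaSum, finsum_eq_single _ 0 fun r hr => ?_]
    · rw [mul_zero, zero_add, sparseGenFun_one]; simp [gaussBinom.apply_zero]
    · rcases lt_or_gt_of_ne hr with h | h
      · rw [gaussBinom.eq_zero_of_lt _ (by push_cast; omega), mul_zero]
      · rw [gaussBinom.eq_zero_of_neg _ _ (by push_cast; omega), mul_zero]
  | one =>
    -- The condition `0 ≤ 1 - 3r ≤ 4` leaves `r = 0, -1`, giving `[4,1] - q [4,4]`.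
    rw [thetaSum, finsum_eq_sum_of_support_subset (s := {0, -1}) _ fun r hr => ?_]
    · rw [mul_one, sparseGenFun_three]
      simp [gaussBinom.succ_apply, gaussBinom.zero_apply]
      ring
    · by_contra h
      apply hr
      simp only [Finset.coe_insert, Finset.coe_singleton, Set.mem_insert_iff,
        Set.mem_singleton_iff, not_or] at h
      rcases lt_or_gt_of_ne h.1 with h' | h'
      · rw [gaussBinom.eq_zero_of_lt _ (by push_cast; omega), mul_zero]
      · rw [gaussBinom.eq_zero_of_neg _ _ (by push_cast; omega), mul_zero]
  | more L ih1 ih2 =>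
    have h1 := thetaSum.recurrence hq L
    have h2 := sparseGenFun_recurrence L
    rw [show 2 * (L + 1) + 1 = 2 * L + 3 by ring, show 2 * (L + 1) + 2 = 2 * L + 4 by ring] at ih2
    rw [show 2 * (L + 2) + 1 = 2 * L + 5 by ring, show 2 * (L + 2) + 2 = 2 * L + 6 by ring, h2]
    push_cast at *
    rw [h1, ← ih1, ← ih2]
    simp

/-! ### From chains of partitions to sparse sets. -/

namespace RogersRamanujan

theorem leastPart_image (a ℓ : ℕ) (hℓ : 0 < ℓ) :
    leastPart ((Finset.range ℓ).image fun j => a + 2 * j) = a := by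
  refine IsLeast.csInf_eq ⟨?_, ?_⟩
  · exact Finset.mem_coe.2 (Finset.mem_image.2 ⟨0, Finset.mem_range.2 hℓ, by simp⟩)
  · intro b hb
    obtain ⟨j, -, rfl⟩ := Finset.mem_image.1 (Finset.mem_coe.1 hb)
    omega

variable {n : ℕ} {π : n.Partition}

theorem mem_chains {χ : Finset ℕ} : χ ∈ chains π ↔ IsChain π χ := by
  simp only [chains, Finset.mem_filter, Finset.mem_powerset, and_iff_right_iff_imp]
  exact fun h m hm => Multiset.mem_toFinset.2 (h.prop.2 m hm)

/-- A block of parts with least part `a` is a chain iff it cannot be prolonged. -/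
theorem isChain_image_iff (a ℓ : ℕ) (hℓ : 0 < ℓ) (ha : 2 ≤ a) :
    IsChain π ((Finset.range ℓ).image fun j => a + 2 * j) ↔
      (∀ j < ℓ, a + 2 * j ∈ π.parts) ∧ a - 2 ∉ π.parts ∧ a + 2 * ℓ ∉ π.parts := by
  constructor
  · intro h
    have hmem : ∀ j < ℓ, a + 2 * j ∈ π.parts := fun j hj =>
      h.prop.2 _ (Finset.mem_image_of_mem _ (Finset.mem_range.2 hj))
    refine ⟨hmem, fun h' => ?_, fun h' => ?_⟩
    · have h2 := h.2 (y := (Finset.range (ℓ + 1)).image fun j => (a - 2) + 2 * j)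
        ⟨⟨_, _, Nat.succ_pos _, rfl⟩, ?_⟩ ?_
      · have : a - 2 ∈ (Finset.range (ℓ + 1)).image fun j => (a - 2) + 2 * j :=
          Finset.mem_image.2 ⟨0, by simp, by simp⟩
        obtain ⟨j, -, hj⟩ := Finset.mem_image.1 (h2 this)
        omega
      · intro m hm
        obtain ⟨j, hj, rfl⟩ := Finset.mem_image.1 hm
        rw [Finset.mem_range] at hj
        rcases j with _ | j
        · simpa using h'
        · have := hmem j (by omega)
          rwa [show a - 2 + 2 * (j + 1) = a + 2 * j by omega]
      · intro m hm
        obtain ⟨j, hj, rfl⟩ := Finset.mem_image.1 hm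
        rw [Finset.mem_range] at hj
        exact Finset.mem_image.2 ⟨j + 1, Finset.mem_range.2 (by omega), by omega⟩
    · have h2 := h.2 (y := (Finset.range (ℓ + 1)).image fun j => a + 2 * j)
        ⟨⟨_, _, Nat.succ_pos _, rfl⟩, ?_⟩ ?_
      · have : a + 2 * ℓ ∈ (Finset.range (ℓ + 1)).image fun j => a + 2 * j :=
          Finset.mem_image.2 ⟨ℓ, by simp, rfl⟩
        obtain ⟨j, hj, hj'⟩ := Finset.mem_image.1 (h2 this)
        rw [Finset.mem_range] at hj
        omega
      · intro m hm
        obtain ⟨j, hj, rfl⟩ := Finset.mem_image.1 hm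
        rw [Finset.mem_range] at hj
        rcases Nat.lt_succ_iff_lt_or_eq.1 hj with hj | rfl
        · exact hmem j hj
        · exact h'
      · exact Finset.image_subset_image (Finset.range_subset_range.2 (Nat.le_succ _))
  · rintro ⟨h1, h2, h3⟩
    refine ⟨⟨⟨a, ℓ, hℓ, rfl⟩, fun m hm => ?_⟩, ?_⟩
    · obtain ⟨j, hj, rfl⟩ := Finset.mem_image.1 hm
      exact h1 j (Finset.mem_range.1 hj)
    · rintro _ ⟨⟨b, k, hk, rfl⟩, hb⟩ hle m hm
      have hb' : ∀ j < k, b + 2 * j ∈ π.parts := fun j hj =>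
        hb _ (Finset.mem_image_of_mem _ (Finset.mem_range.2 hj))
      obtain ⟨i, hi, hi'⟩ := Finset.mem_image.1
        (hle (Finset.mem_image.2 ⟨0, Finset.mem_range.2 hℓ, rfl⟩))
      obtain ⟨j, hj, rfl⟩ := Finset.mem_image.1 hm
      rw [Finset.mem_range] at hi hj
      have hi0 : i = 0 := by
        by_contra h
        have := hb' (i - 1) (by omega)
        exact h2 (by rwa [show b + 2 * (i - 1) = a - 2 by omega] at this)
      subst hi0
      refine Finset.mem_image.2 ⟨j, Finset.mem_range.2 ?_, by omega⟩
      by_contra h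
      have := hb' ℓ (by omega)
      exact h3 (by rwa [show b + 2 * ℓ = a + 2 * ℓ by omega] at this)

theorem exists_chain {a : ℕ} (ha : 2 ≤ a) (h : a ∈ π.parts) (h2 : a - 2 ∉ π.parts) :
    ∃ ℓ, 0 < ℓ ∧ IsChain π ((Finset.range ℓ).image fun j => a + 2 * j) := by
  classical
  have hex : ∃ ℓ, a + 2 * ℓ ∉ π.parts :=
    ⟨n, fun h' => by have := Nat.Partition.le_of_mem_parts h'; omega⟩
  have hpos : 0 < Nat.find hex := by
    rw [Nat.find_pos]
    simpa using h
  exact ⟨Nat.find hex, hpos, (isChain_image_iff a _ hpos ha).2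
    ⟨fun j hj => not_not.1 (Nat.find_min hex hj), h2, Nat.find_spec hex⟩⟩

theorem IsChain.eq_image {χ : Finset ℕ} (h : IsChain π χ) :
    ∃ ℓ, 0 < ℓ ∧ χ = (Finset.range ℓ).image fun j => leastPart χ + 2 * j := by
  obtain ⟨a, ℓ, hℓ, rfl⟩ := h.prop.1
  exact ⟨ℓ, hℓ, by rw [leastPart_image a ℓ hℓ]⟩

/-- A chain is determined by its least part `a`, and a part `a > 2` starts a chain iff `a - 2` is
not a part. -/
theorem card_evenChains (π : n.Partition) :
    (evenChains π).card = (evenStarts π.parts.toFinset).card := by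
  refine Finset.card_bij (fun χ _ => leastPart χ) ?_ ?_ ?_
  · intro χ hχ
    obtain ⟨hc, he, hl⟩ := by simpa [evenChains, mem_chains] using hχ
    obtain ⟨ℓ, hℓ, h⟩ := hc.eq_image
    have hmem : leastPart χ ∈ χ := by
      rw [h, leastPart_image _ _ hℓ]
      exact Finset.mem_image.2 ⟨0, Finset.mem_range.2 hℓ, rfl⟩
    rw [h] at hc
    have h2 := ((isChain_image_iff _ _ hℓ hl.le).1 hc)
    simp only [evenStarts, Finset.mem_filter, Multiset.mem_toFinset]
    exact ⟨by simpa using h2.1 0 hℓ, he _ hmem, hl, h2.2.1⟩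
  · intro χ hχ ψ hψ heq
    obtain ⟨hc, -, hl⟩ := by simpa [evenChains, mem_chains] using hχ
    obtain ⟨hd, -, -⟩ := by simpa [evenChains, mem_chains] using hψ
    obtain ⟨ℓ, hℓ, h⟩ := hc.eq_image
    obtain ⟨k, hk, h'⟩ := hd.eq_image
    have heq' : leastPart χ = leastPart ψ := heq
    rw [h] at hc
    rw [h', ← heq'] at hd
    have h1 := (isChain_image_iff _ _ hℓ hl.le).1 hc
    have h2 := (isChain_image_iff _ _ hk hl.le).1 hd
    have : ℓ = k := le_antisymm (not_lt.1 fun hlt => h2.2.2 (h1.1 _ hlt))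
      (not_lt.1 fun hlt => h1.2.2 (h2.1 _ hlt))
    rw [h, h', this, heq']
  · intro a ha
    simp only [evenStarts, Finset.mem_filter, Multiset.mem_toFinset] at ha
    obtain ⟨ha, he, hl, h2⟩ := ha
    obtain ⟨ℓ, hℓ, h⟩ := exists_chain hl.le ha h2
    refine ⟨_, ?_, leastPart_image a ℓ hℓ⟩
    simp only [evenChains, Finset.mem_filter, mem_chains]
    refine ⟨h, fun m hm => ?_, by rwa [leastPart_image a ℓ hℓ]⟩
    obtain ⟨j, -, rfl⟩ := Finset.mem_image.1 hm
    exact he.add (even_two_mul j)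

theorem mem_rr2 : π ∈ rr2 n ↔ IsRR π ∧ 1 ∉ π.parts := by
  simp [rr2]

theorem sum_weight2 (n m : ℕ) (hm : n ≤ m) : ∑ π ∈ rr2 n, weight2 π =
    ∑ S ∈ (sparseSets m).filter (fun S => ∑ a ∈ S, a = n), 2 ^ (evenStarts S).card := by
  classical
  refine Finset.sum_bij (fun π _ => π.parts.toFinset) ?_ ?_ ?_ ?_
  · intro π hπ
    obtain ⟨⟨hd, hs⟩, h1⟩ := mem_rr2.1 hπ
    simp only [Finset.mem_filter, mem_sparseSets, Multiset.mem_toFinset]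
    refine ⟨⟨fun a ha => ⟨?_, (Nat.Partition.le_of_mem_parts ha).trans hm⟩, fun a ha ha' => ?_⟩, ?_⟩
    · have := π.parts_pos ha
      have : a ≠ 1 := fun h => h1 (h ▸ ha)
      omega
    · have := hs a ha _ ha' (Nat.lt_succ_self a)
      omega
    · rw [Finset.sum, Multiset.toFinset_val, hd.dedup, Multiset.map_id', π.parts_sum]
  · intro π hπ ρ hρ h
    obtain ⟨⟨hd, -⟩, -⟩ := mem_rr2.1 hπ
    obtain ⟨⟨hd', -⟩, -⟩ := mem_rr2.1 hρ
    have h := congrArg Finset.val h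
    simp only [Multiset.toFinset_val, hd.dedup, hd'.dedup] at h
    exact Nat.Partition.ext h
  · intro S hS
    simp only [Finset.mem_filter, mem_sparseSets] at hS
    obtain ⟨⟨h1, h2⟩, h3⟩ := hS
    refine ⟨⟨S.val, fun {i} hi => by have := h1 i hi; omega, by rwa [Finset.sum, Multiset.map_id'] at h3⟩, ?_, ?_⟩
    · refine mem_rr2.2 ⟨⟨S.nodup, fun a ha b hb hab => ?_⟩, fun h => by have := h1 1 h; omega⟩
      have : b ≠ a + 1 := fun h => h2 a ha (h ▸ hb)
      omega
    · simp
  · intro π _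
    rw [weight2, card_evenChains]

theorem coeff_sparseGenFun (n m : ℕ) (hm : n ≤ m) :
    PowerSeries.coeff n (sparseGenFun m) = ((∑ π ∈ rr2 n, weight2 π : ℕ) : ℤ) := by
  rw [sum_weight2 n m hm, sparseGenFun, map_sum, Finset.sum_filter, Nat.cast_sum]
  refine Finset.sum_congr rfl fun S _ => ?_
  have : (2 : PowerSeries ℤ) ^ (evenStarts S).card =
      PowerSeries.C (2 ^ (evenStarts S).card : ℤ) := by simp
  rw [this, PowerSeries.coeff_C_mul, PowerSeries.coeff_X_pow]
  by_cases h : n = ∑ a ∈ S, a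
  · rw [if_pos h, if_pos h.symm]; simp
  · rw [if_neg h, if_neg (Ne.symm h)]; simp

end RogersRamanujan

/-! ### Limits of Gaussian binomials at a nilpotent base. -/

section Nilpotent

variable {S : Type*} [CommRing S] {x : S} {N : ℕ}

theorem isUnit_one_sub_pow_succ (hx : x ^ N = 0) (i : ℕ) : IsUnit (1 - x ^ (i + 1)) :=
  (IsNilpotent.pow_succ i ⟨N, hx⟩).isUnit_one_sub

theorem prod_one_sub_pow_eq (hx : x ^ N = 0) {a : ℕ} (ha : N ≤ a) :
    ∏ i ∈ Finset.range a, (1 - x ^ (i + 1)) = ∏ i ∈ Finset.range N, (1 - x ^ (i + 1)) := by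
  obtain ⟨b, rfl⟩ := Nat.exists_eq_add_of_le ha
  rw [Finset.prod_range_add, Finset.prod_eq_one (s := Finset.range b) fun i _ => ?_, mul_one]
  rw [pow_eq_zero_of_le (by omega) hx, sub_zero]

/-- The numerator factors `1 - x^(n-k+i+1)` all equal `1`. This replaces the limit `1/(q;q)_∞`. -/
theorem gaussBinom_mul_prod_of_pow_eq_zero (hx : x ^ N = 0) {n : ℕ} {k : ℤ} (h1 : (N : ℤ) ≤ k)
    (h2 : (N : ℤ) ≤ n - k) :
    gaussBinom x n k * ∏ i ∈ Finset.range N, (1 - x ^ (i + 1)) = 1 := by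
  obtain ⟨a, rfl⟩ : ∃ a : ℕ, k = a := ⟨k.toNat, by omega⟩
  obtain ⟨b, rfl⟩ : ∃ b : ℕ, n = a + b := ⟨n - a, by omega⟩
  rw [← prod_one_sub_pow_eq hx (show N ≤ a by omega), gaussBinom.mul_prod]
  refine Finset.prod_eq_one fun i _ => ?_
  rw [pow_eq_zero_of_le (by omega) hx, sub_zero]

/-- In a truncation, a bilateral sum of Gaussian binomial coefficients is a partial theta series. -/
theorem sum_gaussBinom_mul_prod (hx : x ^ N = 0) {y : S} (hy : y ^ N = 0) {n d : ℕ} {c : ℤ}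
    (h1 : ((d + 1) * N : ℤ) ≤ c) (h2 : ((d + 1) * N : ℤ) ≤ n - c) (s : Finset ℤ) :
    (∑ r ∈ s, (-1) ^ r.natAbs * x ^ (3 * r ^ 2 + 2 * r).toNat * gaussBinom y n (c - d * r)) *
      ∏ i ∈ Finset.range N, (1 - y ^ (i + 1)) =
    ∑ r ∈ s, (-1) ^ r.natAbs * x ^ (3 * r ^ 2 + 2 * r).toNat := by
  rw [Finset.sum_mul]
  refine Finset.sum_congr rfl fun r _ => ?_
  -- If `|r| < N`, both lower arguments stay at least `N`; otherwise `3r² + 2r ≥ |r| ≥ N` kills the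
  -- term.
  rcases lt_or_ge |r| (N : ℤ) with h | h
  · obtain ⟨h3, h4⟩ := abs_lt.1 h
    rw [mul_assoc, gaussBinom_mul_prod_of_pow_eq_zero hy (by nlinarith) (by nlinarith), mul_one]
  · have : N ≤ (3 * r ^ 2 + 2 * r).toNat := by
      rw [← Int.ofNat_le]
      refine h.trans (le_trans ?_ (Int.self_le_toNat _))
      rw [abs_le']
      constructor <;> nlinarith [sq_nonneg r, Int.le_self_sq r, Int.le_self_sq (-r)]
    rw [pow_eq_zero_of_le this hx]
    simp

theorem prod_one_sub_pow_six (x : S) (n : ℕ) : ∏ i ∈ Finset.range (6 * n), (1 - x ^ (i + 1)) =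
    (∏ k ∈ Finset.range n, (1 - x ^ (6 * k + 1)) * (1 - x ^ (6 * k + 5))) *
    (∏ k ∈ Finset.range n,
      (1 - x ^ (6 * k + 2)) * (1 - x ^ (6 * k + 3)) * (1 - x ^ (6 * k + 4))) *
    ∏ k ∈ Finset.range n, (1 - (x ^ 6) ^ (k + 1)) := by
  induction n with
  | zero => simp
  | succ n ih =>
    simp only [mul_add, mul_one, Finset.prod_range_succ] at ih ⊢
    rw [ih]
    ring

end Nilpotent

theorem neg_one_zpow_eq_pow_natAbs {K : Type*} [Field K] (r : ℤ) :
    (-1 : K) ^ r = (-1) ^ r.natAbs := by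
  obtain ⟨n, rfl | rfl⟩ := r.eq_nat_or_neg
  · simp
  · rcases neg_one_pow_eq_or K n with h | h <;> simp [h]

theorem thetaSum_map {R K : Type*} [CommRing R] [Field K] (f : R →+* K) (q : R) (m n : ℕ)
    {d : ℕ} (hd : 0 < d) {c : ℤ} {B : ℕ} (hB : |c| + n ≤ B) :
    thetaSum (f q) (f q ^ m) n d 2 0 c =
      f (∑ r ∈ Finset.Icc (-(B : ℤ)) B, (-1) ^ r.natAbs * q ^ (3 * r ^ 2 + 2 * r).toNat *
        gaussBinom (q ^ m) n (c - d * r)) := by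
  rw [thetaSum, finsum_eq_sum_of_support_subset (s := Finset.Icc (-(B : ℤ)) B) _ fun r hr => ?_]
  · rw [map_sum]
    refine Finset.sum_congr rfl fun r _ => ?_
    have h : 0 ≤ 3 * r ^ 2 + 2 * r := by
      nlinarith [sq_nonneg r, Int.le_self_sq (-r)]
    rw [map_mul, gaussBinom.map, neg_one_zpow_eq_pow_natAbs, add_zero, map_mul, map_pow, map_pow,
      map_pow, map_neg, map_one]
    congr 2
    conv_lhs => rw [← Int.toNat_of_nonneg h]
    exact zpow_natCast _ _
  · by_contra h
    apply hr
    have hc := neg_abs_le c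
    have hc' := le_abs_self c
    have hd' : (1 : ℤ) ≤ d := by exact_mod_cast hd
    rw [Finset.coe_Icc, Set.mem_Icc, not_and_or, not_le, not_le] at h
    rcases h with h | h
    · rw [gaussBinom.eq_zero_of_lt _ (by nlinarith), mul_zero]
    · rw [gaussBinom.eq_zero_of_neg _ _ (by nlinarith), mul_zero]

/-! ### Identities modulo `X ^ N` and the restricted partition series. -/

section Truncation

open PowerSeries

theorem sparseGenFun_eq_sum (L : ℕ) {B : ℕ} (hB : 3 * L + 2 ≤ B) : sparseGenFun (2 * L + 1) =
    ∑ r ∈ Finset.Icc (-(B : ℤ)) B, (-1) ^ r.natAbs * X ^ (3 * r ^ 2 + 2 * r).toNat *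
      gaussBinom X (2 * L + 2) (L - (3 : ℕ) * r) := by
  have hinj := IsFractionRing.injective (PowerSeries ℤ) (FractionRing (PowerSeries ℤ))
  apply hinj
  have h := thetaSum_map (algebraMap (PowerSeries ℤ) (FractionRing (PowerSeries ℤ))) X 1
    (2 * L + 2) (d := 3) (by norm_num) (c := L) (B := B) (by rw [Nat.abs_cast]; push_cast; omega)
  rw [pow_one, pow_one] at h
  exact (algebraMap_sparseGenFun _ hinj L).trans h

theorem prod_eq_sum_gaussBinom (n : ℕ) {B : ℕ} (hB : 3 * n ≤ B) :
    ∏ k ∈ Finset.range n, (1 - (X : PowerSeries ℤ) ^ (6 * k + 1)) * (1 - X ^ (6 * k + 5)) =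
    ∑ r ∈ Finset.Icc (-(B : ℤ)) B, (-1) ^ r.natAbs * X ^ (3 * r ^ 2 + 2 * r).toNat *
      gaussBinom (X ^ 6) (2 * n) (n - (1 : ℕ) * r) := by
  have hinj := IsFractionRing.injective (PowerSeries ℤ) (FractionRing (PowerSeries ℤ))
  apply hinj
  have h := thetaSum_map (algebraMap (PowerSeries ℤ) (FractionRing (PowerSeries ℤ))) X 6
    (2 * n) (d := 1) (by norm_num) (c := n) (B := B) (by rw [Nat.abs_cast]; push_cast; omega)
  rw [← h, Nat.cast_one, thetaSum.eq_prod ((map_ne_zero_iff _ hinj).2 X_ne_zero)]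
  simp

/-- Modulo `X ^ N`, the product over parts `2, 3, 4` modulo `6` inverts `sparseGenFun`. -/
theorem mk_sparseGenFun_mul_prod (N : ℕ) :
    Ideal.Quotient.mk (Ideal.span {(X : PowerSeries ℤ) ^ N}) (sparseGenFun (2 * (4 * N) + 1) *
      ∏ k ∈ Finset.range (4 * N),
        (1 - X ^ (6 * k + 2)) * (1 - X ^ (6 * k + 3)) * (1 - X ^ (6 * k + 4))) = 1 := by
  set φ := Ideal.Quotient.mk (Ideal.span {(X : PowerSeries ℤ) ^ N})
  set x := φ X with hxdef
  have hx : x ^ N = 0 := by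
    rw [hxdef, ← map_pow, Ideal.Quotient.eq_zero_iff_mem]
    exact Ideal.mem_span_singleton_self _
  have hy : (x ^ 6) ^ N = 0 := by rw [← pow_mul, mul_comm, pow_mul, hx, zero_pow (by norm_num)]
  -- A common range for both sums, so that they reduce to the same truncated theta series. The
  -- length `4N` is what `(d+1)N ≤ c` demands for `d = 3`.
  set B := 12 * N + 2
  have e1 := congrArg φ (sparseGenFun_eq_sum (4 * N) (B := B) (by omega))
  have e2 := congrArg φ (prod_eq_sum_gaussBinom (4 * N) (B := B) (by omega))
  simp only [map_sum, map_prod, map_mul, map_pow, map_sub, map_neg, map_one, gaussBinom.map,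
    ← hxdef] at e1 e2 ⊢
  have f1 := sum_gaussBinom_mul_prod hx hx (n := 2 * (4 * N) + 2) (d := 3) (c := (4 * N : ℕ))
    (by push_cast; omega) (by push_cast; omega) (Finset.Icc (-(B : ℤ)) B)
  have f2 := sum_gaussBinom_mul_prod hx hy (n := 2 * (4 * N)) (d := 1) (c := (4 * N : ℕ))
    (by push_cast; omega) (by push_cast; omega) (Finset.Icc (-(B : ℤ)) B)
  rw [← e1, ← prod_one_sub_pow_eq hx (show N ≤ 6 * (4 * N) by omega), prod_one_sub_pow_six,
    prod_one_sub_pow_eq hy (show N ≤ 4 * N by omega)] at f1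
  rw [← e2, ← f1] at f2
  have u1 : IsUnit (∏ k ∈ Finset.range (4 * N), (1 - x ^ (6 * k + 1)) * (1 - x ^ (6 * k + 5))) :=
    IsUnit.prod_iff.2 fun k _ =>
      (isUnit_one_sub_pow_succ hx (6 * k)).mul (isUnit_one_sub_pow_succ hx (6 * k + 4))
  have u2 : IsUnit (∏ i ∈ Finset.range N, (1 - (x ^ 6) ^ (i + 1))) :=
    IsUnit.prod_iff.2 fun k _ => isUnit_one_sub_pow_succ hy k
  apply (u1.mul u2).mul_left_cancel
  rw [mul_one]
  linear_combination -f2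

open scoped PowerSeries.WithPiTopology in
/-- The generating function of partitions with parts restricted by `p` agrees with large partial
products of the geometric series. -/
theorem exists_coeff_restricted_eq (p : ℕ → Prop) [DecidablePred p] (n : ℕ) :
    ∃ m₀, ∀ m ≥ m₀, ∃ f : PowerSeries ℤ,
      f * ∏ i ∈ Finset.range m, (if p (i + 1) then 1 - X ^ (i + 1) else 1) = 1 ∧
      ∀ k ≤ n, coeff k f = ((Nat.Partition.restricted k p).card : ℤ) := by
  -- For discrete coefficients, convergence means each coefficient is eventually constant.
  let _ : TopologicalSpace ℤ := ⊥
  have : DiscreteTopology ℤ := ⟨rfl⟩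
  have h := (Nat.Partition.hasProd_powerSeriesMk_card_restricted ℤ p).tendsto_prod_nat
  have h2 : ∀ k ∈ Finset.range (n + 1), ∀ᶠ m in Filter.atTop, coeff k
      (∏ i ∈ Finset.range m, if p (i + 1) then ∑' j : ℕ, (X : PowerSeries ℤ) ^ ((i + 1) * j)
        else 1) = ((Nat.Partition.restricted k p).card : ℤ) := fun k _ => by
    have := ((WithPiTopology.continuous_coeff ℤ k).tendsto _).comp h
    rw [coeff_mk, nhds_discrete, Filter.tendsto_pure] at this
    exact this
  obtain ⟨m₀, hm₀⟩ := Filter.eventually_atTop.1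
    ((Filter.eventually_all_finset (Finset.range (n + 1))).2 h2)
  refine ⟨m₀, fun m hm => ⟨_, ?_, fun k hk => hm₀ m hm k (Finset.mem_range.2 (by omega))⟩⟩
  rw [← Finset.prod_mul_distrib]
  refine Finset.prod_eq_one fun i _ => ?_
  split_ifs
  · simp_rw [pow_mul]
    exact WithPiTopology.tsum_pow_mul_one_sub_of_constantCoeff_eq_zero (by simp)
  · simp

end Truncation

/-! ### Comparison of coefficients. -/

namespace RogersRamanujan

theorem prod_range_six_mul {M : Type*} [CommMonoid M] (f : ℕ → M) (n : ℕ) :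
    (∏ i ∈ Finset.range (6 * n), if ¬ ((i + 1 : ℕ) : ℤ) ≡ 0 [ZMOD 6] ∧
      ¬ ((i + 1 : ℕ) : ℤ) ≡ 1 [ZMOD 6] ∧ ¬ ((i + 1 : ℕ) : ℤ) ≡ -1 [ZMOD 6] then f (i + 1) else 1) =
    ∏ k ∈ Finset.range n, f (6 * k + 2) * f (6 * k + 3) * f (6 * k + 4) := by
  induction n with
  | zero => simp
  | succ n ih =>
    rw [mul_add, mul_one]
    simp only [Finset.prod_range_succ, ih]
    rw [if_neg (by simp only [Int.ModEq]; omega), if_pos (by simp only [Int.ModEq]; omega),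
      if_pos (by simp only [Int.ModEq]; omega), if_pos (by simp only [Int.ModEq]; omega),
      if_neg (by simp only [Int.ModEq]; omega), if_neg (by simp only [Int.ModEq]; omega)]
    simp [mul_assoc]

end RogersRamanujan

theorem theorem2 (n : ℕ) :
    RogersRamanujan.A61 n = ∑ π ∈ RogersRamanujan.rr2 n, RogersRamanujan.weight2 π := by
  obtain ⟨m₀, hm₀⟩ := exists_coeff_restricted_eq (fun m : ℕ =>
    ¬ (m : ℤ) ≡ 0 [ZMOD 6] ∧ ¬ (m : ℤ) ≡ 1 [ZMOD 6] ∧ ¬ (m : ℤ) ≡ -1 [ZMOD 6]) n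
  obtain ⟨N, hN⟩ : ∃ N, N = m₀ + n + 1 := ⟨_, rfl⟩
  obtain ⟨f, hf, hcoeff⟩ := hm₀ (6 * (4 * N)) (by omega)
  rw [RogersRamanujan.prod_range_six_mul (fun i => 1 - (PowerSeries.X : PowerSeries ℤ) ^ i)] at hf
  have h := mk_sparseGenFun_mul_prod N
  rw [← map_one (Ideal.Quotient.mk _), Ideal.Quotient.eq, Ideal.mem_span_singleton] at h
  have h2 : PowerSeries.X ^ N ∣ sparseGenFun (2 * (4 * N) + 1) - f := by
    refine (h.mul_left f).trans (dvd_of_eq ?_)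
    -- Both series invert the same product modulo `X ^ N`, hence agree there; `n < N` suffices to
    -- compare coefficients.
    linear_combination sparseGenFun (2 * (4 * N) + 1) * hf
  have h3 := PowerSeries.X_pow_dvd_iff.1 h2 n (by omega)
  rw [map_sub, hcoeff n le_rfl, RogersRamanujan.coeff_sparseGenFun n _ (by omega), sub_eq_zero] at h3
  exact Int.natCast_inj.1 h3.symm
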